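/- Let $k\ge 2$, let $\Delta$ be a finite alphabet, and let ${\bf a}=a(0)a(1)a(2)\cdots$ be an infinite word over $\Delta$. The word ${\bf a}$ is \emph{$k$-automatic} if there is a deterministic finite automaton with output (DFAO) over the input alphabet $\{0,\dots,k-1\}$ which, on reading the base-$k$ representation of $n$ (most significant digit first, without leading zeros, the representation of $0$ being the empty word), ends in a state whose output is $a(n)$, for every $n\ge 0$. A nonempty word $x$ is a period of a finite word $w$ if $w=x^n x'$ with $n\ge 1$ and $x'$ a prefix of $x$; for nonempty $w$ let $\exp(w)=|w|/|x|$, where $x$ is the shortest period of $w$. For a nonempty word $w$ and real $\beta\ge 1$ let $w^\beta$ be the shortest prefix of $www\cdots$ of length at least $\beta|w|$. Define, as extended real numbers, $$\mathrm{ice}_1({\bf a})=\sup\{\exp(w) : w \text{ is a nonempty prefix of } {\bf a}\},$$ $$\mathrm{ice}_2({\bf a})=\sup\{\beta\ge 1 : \forall N\ge 1\ \exists w \text{ with } |w|\ge N \text{ and } w^\beta \text{ a prefix of } {\bf a}\}.$$ **Theorem.** If ${\bf a}$ is $k$-automatic, then each of $\mathrm{ice}_1({\bf a})$ and $\mathrm{ice}_2({\bf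 a})$ is either a rational number or $\infty$. Moreover, both are computable: there are algorithms (total computable functions) which, given $k\ge 2$ and a DFAO generating a $k$-automatic sequence ${\bf a}$ (described by its initial state, transition table and output table), output $\mathrm{ice}_1({\bf a})$ and $\mathrm{ice}_2({\bf a})$ respectively, each either as a fraction $p/q$ of integers or as the symbol $\infty$. -/

import Mathlib

namespace AutSeq

/-! ## Finite words, infinite words, exponents -/

/-- The finite word `w` is a prefix of the infinite word `a = a(0) a(1) a(2) ⋯`. -/
def IsPrefixOf {Δ : Type*} (w : List Δ) (a : ℕ → Δ) : Prop :=
  w = (List.range w.length).map a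

/-- The nonempty word `x` is a period of `w`: `w = xⁿ x'` with `n ≥ 1` and `x'` a prefix of `x`. -/
def IsPeriodOf {Δ : Type*} (x w : List Δ) : Prop :=
  x ≠ [] ∧ ∃ n : ℕ, 1 ≤ n ∧ ∃ x' : List Δ, x' <+: x ∧ w = (List.replicate n x).flatten ++ x'

/-- The length of the shortest period of `w` (a nonempty word `w` has the period `w`). -/
noncomputable def minPeriod {Δ : Type*} (w : List Δ) : ℕ :=
  sInf {p : ℕ | ∃ x : List Δ, IsPeriodOf x w ∧ x.length = p}

/-- The exponent `exp(w)` of a nonempty word: its length divided by that of its shortest period. -/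
noncomputable def exponent {Δ : Type*} (w : List Δ) : ℝ :=
  (w.length : ℝ) / (minPeriod w : ℝ)

/-- The power `x ^ β` for real `β ≥ 1`: the shortest prefix of `x x x ⋯` of length at least
`β |x|`. That length is `⌈β |x|⌉`, and `⌈β⌉` copies of `x` are long enough to contain it. -/
noncomputable def realPow {Δ : Type*} (x : List Δ) (β : ℝ) : List Δ :=
  ((List.replicate ⌈β⌉₊ x).flatten).take ⌈β * (x.length : ℝ)⌉₊

/-- `ice₁(a)`: the supremum of the exponents of the nonempty prefixes of `a`. -/
noncomputable def ice₁ {Δ : Type*} (a : ℕ → Δ) : EReal :=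
  sSup {e : EReal | ∃ w : List Δ, w ≠ [] ∧ IsPrefixOf w a ∧ e = ((exponent w : ℝ) : EReal)}

/-- `ice₂(a)`: the supremum of the real numbers `β ≥ 1` for which there are arbitrarily long
words `w` such that `w ^ β` is a prefix of `a`. -/
noncomputable def ice₂ {Δ : Type*} (a : ℕ → Δ) : EReal :=
  sSup {e : EReal | ∃ β : ℝ, e = (β : EReal) ∧ 1 ≤ β ∧
    ∀ N : ℕ, 1 ≤ N → ∃ w : List Δ, N ≤ w.length ∧ IsPrefixOf (realPow w β) a}

/-! ## Automatic sequences -/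

/-- A deterministic automaton with output, reading words over the digits `0, …, k - 1`. -/
structure DFAO (k : ℕ) (σ : Type*) (Δ : Type*) where
  step : σ → Fin k → σ
  start : σ
  out : σ → Δ

/-- The integer `[w]_k` represented in base `k` by the word `w`, most significant digit first. -/
def baseValue {k : ℕ} (w : List (Fin k)) : ℕ :=
  w.foldl (fun v d => k * v + (d : ℕ)) 0

/-- `w` is a canonical encoding: it does not begin with the digit `0`
(so the canonical encoding of the integer `0` is the empty word). -/
def IsCanonical {k : ℕ} (w : List (Fin k)) : Prop :=
  ∀ d ∈ w.head?, (d : ℕ) ≠ 0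

/-- The output of the last state encountered on reading `w`. -/
def DFAO.eval {k : ℕ} {σ Δ : Type*} (M : DFAO k σ Δ) (w : List (Fin k)) : Δ :=
  M.out (w.foldl M.step M.start)

/-- `M` generates `a`: on the canonical base-`k` encoding of `n`, its output is `a n`. -/
def DFAO.Generates {k : ℕ} {σ Δ : Type*} (M : DFAO k σ Δ) (a : ℕ → Δ) : Prop :=
  ∀ w : List (Fin k), IsCanonical w → M.eval w = a (baseValue w)

/-- `a` is `k`-automatic: it is generated by an automaton with finitely many states. -/
def IsAutomatic {Δ : Type*} (k : ℕ) (a : ℕ → Δ) : Prop :=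
  2 ≤ k ∧ ∃ (σ : Type) (_ : Finite σ) (M : DFAO k σ Δ), M.Generates a

/-! ## Automata as input of an algorithm, extended rationals as its output -/

/-- A finite description of an automaton: the base, the initial state, the transition table
(one row for each state, one entry for each digit), and the list of outputs of the states. -/
abbrev DFAOCode : Type := ℕ × ℕ × List (List ℕ) × List ℕ

/-- The description of an automaton with states `0, …, n - 1`, where the letter `c` of the output
alphabet is written as the number `name c`. -/
def DFAO.code {k n : ℕ} {Δ : Type*} (M : DFAO k (Fin n) Δ) (name : Δ → ℕ) : DFAOCode :=
  (k, (M.start : ℕ),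
    List.ofFn (fun q : Fin n => List.ofFn (fun d : Fin k => (M.step q d : ℕ))),
    List.ofFn (fun q : Fin n => name (M.out q)))

/-- `r` denotes `α`: `none` denotes `∞`, and `some (p, q)` with `q ≠ 0` denotes `p / q`. -/
def Denotes : Option (ℕ × ℕ) → EReal → Prop
  | none, α => α = ⊤
  | some (p, q), α => q ≠ 0 ∧ α = (((p : ℝ) / (q : ℝ) : ℝ) : EReal)

/-- `α` is a rational number or `∞`. -/
def RationalOrInfinite (α : EReal) : Prop :=
  α = ⊤ ∨ ∃ r : ℚ, α = ((r : ℝ) : EReal)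

end AutSeq

open AutSeq

namespace AutSeq

/-! Let `R` be the set of pairs `(p, m)` such that the prefix of length `p + m` has period `p`. Then
`ice₁` is `1 + sup m / p` over `R`, and `ice₂` is `1 + limsup m / p` as `p → ∞`. The set `R` is
recognized by a finite automaton reading `p` and `m` in parallel (`isDigitwise_repetitionState`), so
it can be pumped.

If the leading digits pass twice through the same state, at values `(a₀, b₀)` and then `(a, b)`, put
`(D₁, D₂) = (a, b) - (a₀, b₀)`. Cutting out the loop subtracts a multiple of `(D₁, D₂)` from `(p,
m)`; repeating it adds arbitrarily large ones (`IsDigitwise.pump`). As the loop can be found among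
the first digits, only finitely many directions `(D₁, D₂)` occur.

A vertical direction `(0, D)` makes the whole sequence periodic, and both exponents are infinite.
Otherwise every element of `R` is a small element plus multiples of directions. So the limsup of the
slopes is the largest slope of a direction, and the supremum is the largest slope among directions
and small elements (`IsPumpable.exists_limsup`, `IsPumpable.exists_sup`). Both are of the form `P /
N!`.

For computability, such a slope need only be located to within `1 / (2 N!)`, and pumping bounds the
elements that do so (`findGreatest_hasSlope`). The search has only bounded quantifiers, hence is
primitive recursive. -/

/-! ## Pumping for pairs of integers read digit by digit -/

/-- The state `f p m` reached after reading `p` and `m` in parallel, most significant digit first,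
determines the state after any further digits. -/
def IsDigitwise {Q : Type*} (k : ℕ) (f : ℕ → ℕ → Q) : Prop :=
  ∀ p m p' m', f p m = f p' m' → ∀ d < k, ∀ e < k,
    f (k * p + d) (k * m + e) = f (k * p' + d) (k * m' + e)

theorem exists_lt_map_eq {Q : Type*} [Finite Q] (g : ℕ → Q) :
    ∃ i i', i < i' ∧ i' ≤ Nat.card Q ∧ g i = g i' := by
  have := Fintype.ofFinite Q
  obtain ⟨x, y, hxy, h⟩ := Fintype.exists_ne_map_eq_of_card_lt
    (fun i : Fin (Nat.card Q + 1) => g i) (by simp [Nat.card_eq_fintype_card])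
  have hx := x.2
  have hy := y.2
  rcases lt_or_gt_of_ne hxy with h' | h'
  · exact ⟨x, y, h', by omega, h⟩
  · exact ⟨y, x, h', by omega, h.symm⟩

theorem IsDigitwise.append {Q : Type*} {k : ℕ} {f : ℕ → ℕ → Q} (hf : IsDigitwise k f)
    {p m p' m' : ℕ} (h : f p m = f p' m') (j : ℕ) :
    ∀ u < k ^ j, ∀ v < k ^ j,
      f (k ^ j * p + u) (k ^ j * m + v) = f (k ^ j * p' + u) (k ^ j * m' + v) := by
  induction j with
  | zero => intro u hu v hv; simp at hu hv; simpa [hu, hv] using h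
  | succ j ih =>
    intro u hu v hv
    have hk : 0 < k := Nat.pos_of_ne_zero (by rintro rfl; simp at hu)
    rw [pow_succ] at hu hv
    have e : ∀ x w : ℕ, k ^ (j + 1) * x + w = k * (k ^ j * x + w / k) + w % k := by
      intro x w
      conv_lhs => rw [← Nat.div_add_mod w k]
      ring
    rw [e p, e m, e p', e m']
    exact hf _ _ _ _ (ih _ (Nat.div_lt_of_lt_mul (by rwa [mul_comm])) _
      (Nat.div_lt_of_lt_mul (by rwa [mul_comm]))) _ (Nat.mod_lt _ hk) _ (Nat.mod_lt _ hk)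

theorem pow_mul_div_add_mod_lt {k i s r u : ℕ} (hk : 0 < k) (hu : u < k ^ (i + s + r)) :
    k ^ i * (u / k ^ (i + s)) + u % k ^ i < k ^ (i + r) := by
  have h1 : u / k ^ (i + s) < k ^ r := Nat.div_lt_of_lt_mul (by rwa [← pow_add])
  have h2 : u % k ^ i < k ^ i := Nat.mod_lt _ (by positivity)
  calc k ^ i * (u / k ^ (i + s)) + u % k ^ i < k ^ i * (u / k ^ (i + s)) + k ^ i := by omega
    _ = k ^ i * (u / k ^ (i + s) + 1) := by ring
    _ ≤ k ^ i * k ^ r := Nat.mul_le_mul_left _ h1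
    _ = k ^ (i + r) := by rw [pow_add]

/-- A state reached from `f p m` is reached from it by a short word. -/
theorem IsDigitwise.shorten {Q : Type*} [Finite Q] {k : ℕ} {f : ℕ → ℕ → Q}
    (hf : IsDigitwise k f) (hk : 0 < k) (p m : ℕ) (j : ℕ) :
    ∀ u < k ^ j, ∀ v < k ^ j, ∃ i ≤ Nat.card Q, ∃ u' < k ^ i, ∃ v' < k ^ i,
      f (k ^ i * p + u') (k ^ i * m + v') = f (k ^ j * p + u) (k ^ j * m + v) := by
  induction j using Nat.strong_induction_on with
  | _ j ih =>
    intro u hu v hv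
    by_cases hj : j ≤ Nat.card Q
    · exact ⟨j, hj, u, hu, v, hv, rfl⟩
    -- Compare the states before the last `i` digits. Two of them agree, and the block of `s` digits
    -- between them is cut out, leaving a word of length `i + r`.
    obtain ⟨i, i', hii, hi', h⟩ := exists_lt_map_eq
      (fun i => f ((k ^ j * p + u) / k ^ i) ((k ^ j * m + v) / k ^ i))
    obtain ⟨s, rfl⟩ : ∃ s, i' = i + s := ⟨i' - i, by omega⟩
    obtain ⟨r, rfl⟩ : ∃ r, j = i + s + r := ⟨j - (i + s), by omega⟩
    have hki : 0 < k ^ i := by positivity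
    have e : ∀ x w : ℕ, k ^ (i + r) * x + (k ^ i * (w / k ^ (i + s)) + w % k ^ i)
        = k ^ i * ((k ^ (i + s + r) * x + w) / k ^ (i + s))
          + (k ^ (i + s + r) * x + w) % k ^ i := by
      intro x w
      have h1 : k ^ (i + s + r) * x + w = k ^ (i + s) * (k ^ r * x) + w := by ring
      have h2 : k ^ (i + s + r) * x + w = w + k ^ i * (k ^ (s + r) * x) := by ring
      have h3 : (k ^ (i + s + r) * x + w) / k ^ (i + s) = k ^ r * x + w / k ^ (i + s) := by
        rw [h1, Nat.mul_add_div (by positivity)]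
      rw [h3, h2, Nat.add_mul_mod_self_left]
      ring
    obtain ⟨l, hl, u', hu', v', hv', h'⟩ := ih (i + r) (by omega) _
      (pow_mul_div_add_mod_lt hk hu) _ (pow_mul_div_add_mod_lt hk hv)
    refine ⟨l, hl, u', hu', v', hv', h'.trans ?_⟩
    rw [e, e, hf.append h.symm i _ (Nat.mod_lt _ hki) _ (Nat.mod_lt _ hki), Nat.div_add_mod,
      Nat.div_add_mod]

/-- The pumping lemma: a large pair can be shortened along a small direction `(D₁, D₂)`, and there
is a small pair from which one can go arbitrarily far in this direction, within known bounds. -/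
theorem IsDigitwise.pump {Q : Type*} [Finite Q] {k : ℕ} {f : ℕ → ℕ → Q}
    (hf : IsDigitwise k f) (hk : 2 ≤ k) {N : ℕ} (hN : N = k ^ Nat.card Q) {p m : ℕ}
    (hpm : N ≤ p ∨ N ≤ m) :
    ∃ D₁ D₂, D₁ < N ∧ D₂ < N ∧ (0 < D₁ ∨ 0 < D₂) ∧
      (∃ p' m' c, 0 < c ∧ p = p' + c * D₁ ∧ m = m' + c * D₂ ∧ f p' m' = f p m) ∧
      ∃ x < N ^ 2, ∃ y < N ^ 2, ∀ r, ∃ c, r ≤ c ∧ c ≤ (2 * N) ^ (r + 1) ∧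
        f (x + c * D₁) (y + c * D₂) = f p m := by
  have hk0 : 0 < k := by omega
  set t := Nat.card Q with ht
  obtain ⟨L, hL⟩ : ∃ L, L = Nat.log k (max p m) := ⟨_, rfl⟩
  have hmax : N ≤ max p m := by rcases hpm with h | h <;> simp [h]
  have hNpos : 0 < N := by rw [hN]; positivity
  have hlow : k ^ L ≤ max p m := by
    rw [hL]; exact Nat.pow_log_le_self _ (by omega)
  have hup : max p m < k ^ (L + 1) := by
    rw [hL]; exact Nat.lt_pow_succ_log_self (by omega) _
  have htL : t < L + 1 := by
    refine (Nat.pow_lt_pow_iff_right (show 1 < k by omega)).1 ?_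
    omega
  -- Both numbers are written with `L + 1` digits, the shorter one padded with zeros; two of the
  -- states after the first `i` digits, `i ≤ t`, agree.
  obtain ⟨i, i', hii, hi', h⟩ := exists_lt_map_eq
    (fun i => f (p / k ^ (L + 1 - i)) (m / k ^ (L + 1 - i)))
  obtain ⟨l, rfl⟩ : ∃ l, i' = i + l := ⟨i' - i, by omega⟩
  obtain ⟨j, hj⟩ : ∃ j, L + 1 = j + (i + l) := ⟨L + 1 - (i + l), by omega⟩
  have e1 : L + 1 - i = j + l := by omega
  have e2 : L + 1 - (i + l) = j := by omega
  simp only [e1, e2] at h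
  rw [pow_add, ← Nat.div_div_eq_div_mul, ← Nat.div_div_eq_div_mul] at h
  have hkj : 0 < k ^ j := by positivity
  have hkl : 0 < k ^ l := by positivity
  have hkl1 : 1 < k ^ l := Nat.one_lt_pow (by omega) (by omega)
  have hklN : k ^ l ≤ N := by rw [hN]; exact Nat.pow_le_pow_right hk0 (by omega)
  have small : ∀ z, z ≤ max p m → z / k ^ j < N := by
    intro z hz
    have h1 : z / k ^ j < k ^ (i + l) :=
      Nat.div_lt_of_lt_mul (by rw [← pow_add, ← hj]; omega)
    exact h1.trans_le (by rw [hN]; exact Nat.pow_le_pow_right hk0 hi')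
  have hjL : k ^ j ≤ max p m := le_trans (Nat.pow_le_pow_right hk0 (by omega)) hlow
  have hpos : 0 < p / k ^ j ∨ 0 < m / k ^ j := by
    rcases le_max_iff.1 hjL with h' | h'
    · exact Or.inl (Nat.div_pos h' hkj)
    · exact Or.inr (Nat.div_pos h' hkj)
  have hp : k ^ j * (p / k ^ j) + p % k ^ j = p := Nat.div_add_mod _ _
  have hm : k ^ j * (m / k ^ j) + m % k ^ j = m := Nat.div_add_mod _ _
  have hpj := Nat.mod_lt p hkj
  have hmj := Nat.mod_lt m hkj
  have ha := small p (le_max_left _ _)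
  have hb := small m (le_max_right _ _)
  generalize p / k ^ j = a at *
  generalize m / k ^ j = b at *
  generalize p % k ^ j = w₁ at *
  generalize m % k ^ j = w₂ at *
  have ha0 : k ^ l * (a / k ^ l) + a % k ^ l = a := Nat.div_add_mod _ _
  have hb0 : k ^ l * (b / k ^ l) + b % k ^ l = b := Nat.div_add_mod _ _
  have hal := Nat.mod_lt a hkl
  have hbl := Nat.mod_lt b hkl
  have ha1 : 0 < a → a / k ^ l < a := fun h => Nat.div_lt_self h hkl1
  have hb1 : 0 < b → b / k ^ l < b := fun h => Nat.div_lt_self h hkl1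
  obtain ⟨D₁, hD₁⟩ : ∃ D, a = a / k ^ l + D := Nat.exists_eq_add_of_le (Nat.div_le_self _ _)
  obtain ⟨D₂, hD₂⟩ : ∃ D, b = b / k ^ l + D := Nat.exists_eq_add_of_le (Nat.div_le_self _ _)
  generalize a / k ^ l = a₀ at *
  generalize b / k ^ l = b₀ at *
  generalize a % k ^ l = v₁ at *
  generalize b % k ^ l = v₂ at *
  -- Appending the loop digits `(v₁, v₂)` to `a + c * D₁`, `b + c * D₂` returns to the same state
  -- and replaces `c` by `k ^ l * (c + 1)`.
  have up : ∀ r, ∃ c, r ≤ c ∧ c ≤ (2 * N) ^ r ∧ f (a + c * D₁) (b + c * D₂) = f a b := by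
    intro r
    induction r with
    | zero => exact ⟨0, le_rfl, by simp, by simp⟩
    | succ r ih =>
      obtain ⟨c, hrc, hc, hfc⟩ := ih
      refine ⟨k ^ l * (c + 1), ?_, ?_, ?_⟩
      · nlinarith
      · have : 1 ≤ (2 * N) ^ r := Nat.one_le_pow _ _ (by omega)
        calc k ^ l * (c + 1) ≤ N * ((2 * N) ^ r + (2 * N) ^ r) := by gcongr
          _ = (2 * N) ^ (r + 1) := by ring
      · have g := hf.append (hfc.trans h.symm) l v₁ hal v₂ hbl
        rw [ha0, hb0] at g
        rw [← g]
        congr 1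
        · calc a + k ^ l * (c + 1) * D₁ = (k ^ l * a₀ + v₁) + k ^ l * (c + 1) * D₁ := by rw [ha0]
            _ = k ^ l * ((a₀ + D₁) + c * D₁) + v₁ := by ring
            _ = _ := by rw [← hD₁]
        · calc b + k ^ l * (c + 1) * D₂ = (k ^ l * b₀ + v₂) + k ^ l * (c + 1) * D₂ := by rw [hb0]
            _ = k ^ l * ((b₀ + D₂) + c * D₂) + v₂ := by ring
            _ = _ := by rw [← hD₂]
  refine ⟨D₁, D₂, by omega, by omega, by omega, ⟨k ^ j * a₀ + w₁, k ^ j * b₀ + w₂, k ^ j, hkj,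
    ?_, ?_, ?_⟩, ?_⟩
  · rw [← hp]; conv_lhs => rw [hD₁]
    ring
  · rw [← hm]; conv_lhs => rw [hD₂]
    ring
  · conv_rhs => rw [← hp, ← hm]
    exact hf.append h j _ hpj _ hmj
  -- The tail after the loop may be long; replacing it by a short word leading to the same state
  -- keeps the base point below `N ^ 2`.
  · obtain ⟨s, hs, u', hu', v', hv', h'⟩ := hf.shorten hk0 a b j w₁ hpj w₂ hmj
    have hsN : k ^ s ≤ N := by rw [hN]; exact Nat.pow_le_pow_right hk0 hs
    have bound : ∀ z w, z < N → w < k ^ s → k ^ s * z + w < N ^ 2 := by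
      intro z w hz hw
      calc k ^ s * z + w < k ^ s * (z + 1) := by rw [mul_add]; omega
        _ ≤ N * N := Nat.mul_le_mul hsN hz
        _ = N ^ 2 := by ring
    refine ⟨k ^ s * a + u', bound _ _ ha hu', k ^ s * b + v', bound _ _ hb hv', fun r => ?_⟩
    obtain ⟨c, hrc, hc, hfc⟩ := up r
    refine ⟨k ^ s * c, hrc.trans (Nat.le_mul_of_pos_left _ (by positivity)), ?_, ?_⟩
    · calc k ^ s * c ≤ (2 * N) * (2 * N) ^ r := Nat.mul_le_mul (by omega) hc
        _ = _ := by ring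
    · have g := hf.append hfc s u' hu' v' hv'
      rw [h', hp, hm] at g
      rw [← g]
      congr 1 <;> ring

/-! ## Slopes of pumpable sets of pairs -/

/-- `(D₁, D₂)` is a direction of `R`: from a small base point, one can go arbitrarily far in this
direction without leaving `R`, within known bounds. -/
def IsDirection (N : ℕ) (R : ℕ → ℕ → Prop) (D₁ D₂ : ℕ) : Prop :=
  ∃ x < N ^ 2, ∃ y < N ^ 2, ∀ r, ∃ c, r ≤ c ∧ c ≤ (2 * N) ^ (r + 1) ∧ R (x + c * D₁) (y + c * D₂)

/-- The elements of `R` that are not below `N` can be shortened along a direction below `N`. -/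
def IsPumpable (N : ℕ) (R : ℕ → ℕ → Prop) : Prop :=
  ∀ p m, R p m → (N ≤ p ∨ N ≤ m) → ∃ D₁ D₂, D₁ < N ∧ D₂ < N ∧ (0 < D₁ ∨ 0 < D₂) ∧
    (∃ p' m' c, 0 < c ∧ p = p' + c * D₁ ∧ m = m' + c * D₂ ∧ R p' m') ∧ IsDirection N R D₁ D₂

theorem IsDigitwise.isPumpable {Q : Type*} [Finite Q] {k : ℕ} {f : ℕ → ℕ → Q}
    (hf : IsDigitwise k f) (hk : 2 ≤ k) {R : ℕ → ℕ → Prop}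
    (hR : ∀ p m p' m', f p m = f p' m' → R p m → R p' m') :
    IsPumpable (k ^ Nat.card Q) R := by
  intro p m hpm hN
  obtain ⟨D₁, D₂, h1, h2, h3, ⟨p', m', c, hc, e1, e2, e3⟩, x, hx, y, hy, h⟩ := hf.pump hk rfl hN
  refine ⟨D₁, D₂, h1, h2, h3, ⟨p', m', c, hc, e1, e2, hR _ _ _ _ e3.symm hpm⟩, x, hx, y, hy,
    fun r => ?_⟩
  obtain ⟨c, hrc, hc, e⟩ := h r
  exact ⟨c, hrc, hc, hR _ _ _ _ e.symm hpm⟩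

section Slopes

variable {N : ℕ} {R : ℕ → ℕ → Prop}

/-- If `P / Q` bounds the slopes of the directions, every element of `R` is reached from a small one
by a vector of slope at most `P / Q`. -/
theorem IsPumpable.exists_small (hR : IsPumpable N R) {P Q : ℕ}
    (h : ∀ D₁ D₂, D₁ < N → D₂ < N → (0 < D₁ ∨ 0 < D₂) → IsDirection N R D₁ D₂ →
      Q * D₂ ≤ P * D₁) (p m : ℕ) (hpm : R p m) :
    ∃ x < N, ∃ y < N, R x y ∧ Q * m + P * x ≤ Q * y + P * p := by
  induction hs : p + m using Nat.strong_induction_on generalizing p m with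
  | _ s ih =>
    by_cases hN : N ≤ p ∨ N ≤ m
    · obtain ⟨D₁, D₂, h1, h2, h3, ⟨p', m', c, hc, rfl, rfl, e3⟩, hD⟩ := hR p m hpm hN
      have hlt : p' + m' < s := by
        have : 0 < c * D₁ ∨ 0 < c * D₂ := h3.imp (Nat.mul_pos hc) (Nat.mul_pos hc)
        omega
      obtain ⟨x, hx, y, hy, hxy, hle⟩ := ih _ hlt p' m' e3 rfl
      refine ⟨x, hx, y, hy, hxy, ?_⟩
      have := Nat.mul_le_mul_left c (h D₁ D₂ h1 h2 h3 hD)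
      linarith
    · exact ⟨p, by omega, m, by omega, hpm, le_rfl⟩

/-- Without vertical directions, all directions have slope at most `N - 1`, and so do the small
elements of `R`, as these have positive first coordinate. Together with `IsDirection.exists_steep`,
this turns the existence of a vertical direction into a bounded test. -/
theorem IsPumpable.lt_mul (hR : IsPumpable N R) (hpos : ∀ p m, R p m → 0 < p)
    (hdir : ∀ D, 0 < D → D < N → ¬ IsDirection N R 0 D) {p m : ℕ} (hpm : R p m) : m < N * p := by
  obtain ⟨x, hx, y, hy, hxy, h⟩ := hR.exists_small (P := N - 1) (Q := 1) (by
    intro D₁ D₂ h1 h2 h3 hD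
    have : 0 < D₁ := by
      rcases Nat.eq_zero_or_pos D₁ with rfl | h
      · exact absurd hD (hdir _ (by omega) h2)
      · exact h
    calc 1 * D₂ ≤ (N - 1) * 1 := by omega
      _ ≤ (N - 1) * D₁ := Nat.mul_le_mul_left _ this) p m hpm
  have hx0 := hpos _ _ hxy
  have hp0 := hpos _ _ hpm
  obtain ⟨M, rfl⟩ : ∃ M, N = M + 1 := ⟨N - 1, by omega⟩
  simp only [Nat.add_sub_cancel] at h
  nlinarith

theorem IsDirection.exists_steep {D : ℕ} (h : IsDirection N R 0 D) (hD : 0 < D) (hN : D < N) :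
    ∃ p < N ^ 2, ∃ m < N ^ 2 + (2 * N) ^ (N ^ 3 + 1) * N, R p m ∧ N * p ≤ m := by
  obtain ⟨x, hx, y, hy, h⟩ := h
  -- The base point has `x < N ^ 2`, so height `N ^ 3` already gives slope `N`.
  obtain ⟨c, hc, hc', hR⟩ := h (N ^ 3)
  refine ⟨x, hx, y + c * D, ?_, by simpa using hR, ?_⟩
  · have : c * D ≤ (2 * N) ^ (N ^ 3 + 1) * N := Nat.mul_le_mul hc' hN.le
    omega
  · calc N * x ≤ N * N ^ 2 := Nat.mul_le_mul_left _ hx.le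
      _ = N ^ 3 * 1 := by ring
      _ ≤ c * D := Nat.mul_le_mul hc hD
      _ ≤ y + c * D := Nat.le_add_left _ _

theorem IsDirection.exists_unbounded {D : ℕ} (h : IsDirection N R 0 D) (hD : 0 < D) :
    ∃ p, ∀ M, ∃ m, M ≤ m ∧ R p m := by
  obtain ⟨x, hx, y, hy, h⟩ := h
  refine ⟨x, fun M => ?_⟩
  obtain ⟨c, hc, hc', hR⟩ := h M
  exact ⟨y + c * D, by nlinarith, by simpa using hR⟩

/-- Denominators below `N` divide `N!`, so the finitely many slopes are compared as integers after
multiplication by `N!`. -/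
theorem exists_max_slope {E : ℕ → ℕ → Prop} (hE : ∃ x < N, ∃ y < N, E x y)
    (hpos : ∀ x y, E x y → 0 < x) :
    ∃ P, (∀ x < N, ∀ y < N, E x y → N.factorial * y ≤ P * x) ∧
      ∃ x < N, ∃ y < N, E x y ∧ N.factorial * y = P * x := by
  have hdvd : ∀ x < N, ∀ y, E x y → N.factorial / x * y * x = N.factorial * y := by
    intro x hx y hxy
    rw [mul_right_comm, Nat.div_mul_cancel (Nat.dvd_factorial (hpos _ _ hxy) hx.le)]
  have hfin : {z : ℕ × ℕ | z.1 < N ∧ z.2 < N ∧ E z.1 z.2}.Finite :=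
    ((Set.finite_Iio N).prod (Set.finite_Iio N)).subset fun z hz => ⟨hz.1, hz.2.1⟩
  obtain ⟨x, hx, y, hy, hxy⟩ := hE
  obtain ⟨z, ⟨hz1, hz2, hz⟩, hmax⟩ := Set.exists_max_image _
    (fun z : ℕ × ℕ => N.factorial / z.1 * z.2) hfin ⟨(x, y), hx, hy, hxy⟩
  refine ⟨N.factorial / z.1 * z.2, fun x hx y hy hxy => ?_, z.1, hz1, z.2, hz2, hz,
    (hdvd _ hz1 _ hz).symm⟩
  rw [← hdvd x hx y hxy]
  exact Nat.mul_le_mul_right _ (hmax (x, y) ⟨hx, hy, hxy⟩)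

/-- The slope `P / N!` is attained: by a direction, or by a small element of `R` with `K ≤ p`. -/
def IsAttained (N K : ℕ) (R : ℕ → ℕ → Prop) (P : ℕ) : Prop :=
  (∃ D₁ < N, ∃ D₂ < N, 0 < D₁ ∧ IsDirection N R D₁ D₂ ∧ N.factorial * D₂ = P * D₁) ∨
    ∃ p < N, ∃ m < N, K ≤ p ∧ 0 < p ∧ R p m ∧ N.factorial * m = P * p

theorem IsPumpable.direction_le (hdir : ∀ D, 0 < D → D < N → ¬ IsDirection N R 0 D) {P : ℕ}
    (hP : ∀ x < N, ∀ y < N, (0 < x ∧ IsDirection N R x y) → N.factorial * y ≤ P * x) :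
    ∀ D₁ D₂, D₁ < N → D₂ < N → (0 < D₁ ∨ 0 < D₂) → IsDirection N R D₁ D₂ →
      N.factorial * D₂ ≤ P * D₁ := by
  intro D₁ D₂ h1 h2 h3 hD
  rcases Nat.eq_zero_or_pos D₁ with rfl | h
  · exact absurd hD (hdir _ (by omega) h2)
  · exact hP _ h1 _ h2 ⟨h, hD⟩

/-- Here only directions compete for the largest slope. The small element from which a given one is
reached costs the additive error `N! * N`, which is harmless for large `p`. -/
theorem IsPumpable.exists_limsup (hR : IsPumpable N R)
    (hdir : ∀ D, 0 < D → D < N → ¬ IsDirection N R 0 D) (hne : ∃ p, N ≤ p ∧ ∃ m, R p m) (K : ℕ) :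
    ∃ P, (∀ p m, R p m → N.factorial * m ≤ N.factorial * N + P * p) ∧ IsAttained N K R P ∧
      ∃ D₁ < N, ∃ D₂ < N, 0 < D₁ ∧ IsDirection N R D₁ D₂ ∧ N.factorial * D₂ = P * D₁ := by
  obtain ⟨p, hp, m, hpm⟩ := hne
  obtain ⟨D₁, D₂, h1, h2, h3, -, hD⟩ := hR p m hpm (Or.inl hp)
  have hD₁ : 0 < D₁ := by
    rcases Nat.eq_zero_or_pos D₁ with rfl | h
    · exact absurd hD (hdir _ (by omega) h2)
    · exact h
  obtain ⟨P, hP, x, hx, y, hy, ⟨hx0, hxy⟩, e⟩ := exists_max_slope (N := N)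
    (E := fun x y => 0 < x ∧ IsDirection N R x y) ⟨D₁, h1, D₂, h2, hD₁, hD⟩ (fun _ _ h => h.1)
  have hw : ∃ D₁ < N, ∃ D₂ < N, 0 < D₁ ∧ IsDirection N R D₁ D₂ ∧ N.factorial * D₂ = P * D₁ :=
    ⟨x, hx, y, hy, hx0, hxy, e⟩
  refine ⟨P, fun p m hpm => ?_, Or.inl hw, hw⟩
  obtain ⟨x, hx, y, hy, hxy, h⟩ := hR.exists_small (IsPumpable.direction_le hdir hP) p m hpm
  have : N.factorial * y ≤ N.factorial * N := Nat.mul_le_mul_left _ hy.le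
  omega

/-- Letting the small elements of `R` compete with the directions removes the additive error. -/
theorem IsPumpable.exists_sup (hR : IsPumpable N R) (hpos : ∀ p m, R p m → 0 < p)
    (hdir : ∀ D, 0 < D → D < N → ¬ IsDirection N R 0 D) (hne : ∃ p, N ≤ p ∧ ∃ m, R p m) :
    ∃ P, (∀ p m, R p m → N.factorial * m ≤ P * p) ∧ IsAttained N 0 R P := by
  obtain ⟨p, hp, m, hpm⟩ := hne
  obtain ⟨D₁, D₂, h1, h2, h3, -, hD⟩ := hR p m hpm (Or.inl hp)
  have hD₁ : 0 < D₁ := by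
    rcases Nat.eq_zero_or_pos D₁ with rfl | h
    · exact absurd hD (hdir _ (by omega) h2)
    · exact h
  obtain ⟨P, hP, x, hx, y, hy, ⟨hx0, hxy⟩, e⟩ := exists_max_slope (N := N)
    (E := fun x y => 0 < x ∧ (IsDirection N R x y ∨ R x y))
    ⟨D₁, h1, D₂, h2, hD₁, Or.inl hD⟩ (fun _ _ h => h.1)
  refine ⟨P, fun p m hpm => ?_, ?_⟩
  · obtain ⟨x, hx, y, hy, hxy, h⟩ := hR.exists_small (IsPumpable.direction_le hdir
      fun x hx y hy h => hP x hx y hy ⟨h.1, Or.inl h.2⟩) p m hpm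
    have := hP x hx y hy ⟨hpos _ _ hxy, Or.inr hxy⟩
    omega
  · rcases hxy with hxy | hxy
    · exact Or.inl ⟨x, hx, y, hy, hx0, hxy, e⟩
    · exact Or.inr ⟨x, hx, y, hy, Nat.zero_le _, hx0, hxy, e⟩

/-- A bound for the witnesses in `HasSlope`. -/
def witnessBound (N : ℕ) : ℕ :=
  N ^ 2 + (2 * N) ^ (2 * (N * N.factorial) * N ^ 2 + 2 * (N.factorial * N) + 1 + 1) * N

/-- `R` has a small element with `K ≤ p` and slope larger than `P / N! - 1 / (2 N!)`. -/
def HasSlope (N K : ℕ) (R : ℕ → ℕ → Prop) (P : ℕ) : Prop :=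
  ∃ p < witnessBound N, ∃ m < witnessBound N,
    K ≤ p ∧ R p m ∧ 2 * P * p < 2 * N.factorial * m + p

theorem IsAttained.le {K P : ℕ} (h : IsAttained N K R P) : P ≤ N * N.factorial := by
  obtain ⟨x, -, y, hy, hx, -, e⟩ | ⟨x, -, y, hy, -, hx, -, e⟩ := h <;>
  · calc P ≤ P * x := Nat.le_mul_of_pos_right _ hx
      _ = N.factorial * y := e.symm
      _ ≤ N.factorial * N := Nat.mul_le_mul_left _ hy.le
      _ = _ := mul_comm _ _

theorem IsAttained.hasSlope {K P : ℕ} (h : IsAttained N K R P)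
    (hK : K ≤ 2 * (N.factorial * N)) : HasSlope N K R P := by
  have hP := h.le
  obtain ⟨D₁, h1, D₂, h2, hD₁, ⟨x, hx, y, hy, hr⟩, e⟩ | ⟨p, hp, m, hm, hKp, hp0, hpm, e⟩ := h
  -- The first term dominates the base point's contribution `2 * P * x`, the second one dominates
  -- `K`, and `+ 1` makes the inequality strict.
  · obtain ⟨c, hc, hc', hR⟩ := hr (2 * (N * N.factorial) * N ^ 2 + 2 * (N.factorial * N) + 1)
    have hb : ∀ D < N, c * D ≤
        (2 * N) ^ (2 * (N * N.factorial) * N ^ 2 + 2 * (N.factorial * N) + 1 + 1) * N :=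
      fun D hD => Nat.mul_le_mul hc' hD.le
    have hcD : c ≤ c * D₁ := Nat.le_mul_of_pos_right _ hD₁
    refine ⟨x + c * D₁, ?_, y + c * D₂, ?_, ?_, hR, ?_⟩
    · have := hb _ h1; unfold witnessBound; omega
    · have := hb _ h2; unfold witnessBound; omega
    · omega
    · have h3 : 2 * P * x ≤ 2 * (N * N.factorial) * N ^ 2 :=
        Nat.mul_le_mul (Nat.mul_le_mul_left _ hP) hx.le
      have h4 : 2 * N.factorial * (y + c * D₂) = 2 * N.factorial * y + 2 * P * (c * D₁) := by
        linear_combination 2 * c * e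
      have h5 : 2 * P * (x + c * D₁) = 2 * P * x + 2 * P * (c * D₁) := by ring
      omega
  · have hN : N ≤ N ^ 2 := by nlinarith
    refine ⟨p, ?_, m, ?_, hKp, hpm, ?_⟩
    · unfold witnessBound; omega
    · unfold witnessBound; omega
    · have : 2 * N.factorial * m = 2 * P * p := by linear_combination 2 * e
      omega

open Classical in
/-- The largest slope with denominator `N!` can be found by looking at small elements. -/
theorem findGreatest_hasSlope {K P : ℕ} (h : IsAttained N K R P)
    (hK : K ≤ 2 * (N.factorial * N)) (hpos : ∀ p m, R p m → 0 < p)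
    (hle : ∀ p m, K ≤ p → R p m → 2 * N.factorial * m ≤ 2 * P * p + p) :
    Nat.findGreatest (HasSlope N K R) (N * N.factorial) = P := by
  rw [Nat.findGreatest_eq_iff]
  refine ⟨h.le, fun _ => h.hasSlope hK, fun P' hP' _ => ?_⟩
  rintro ⟨p, -, m, -, hKp, hpm, hlt⟩
  have h1 := hle p m hKp hpm
  have h2 := hpos p m hpm
  nlinarith

/-- The slope of a direction is approximated by elements of `R` with large `p`. -/
theorem IsDirection.exists_slope_gt {D₁ D₂ P Q : ℕ} (h : IsDirection N R D₁ D₂) (hD₁ : 0 < D₁)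
    (hQ : 0 < Q) (e : Q * D₂ = P * D₁) {t : ℝ} (ht : t < (P : ℝ) / Q) (M : ℕ) :
    ∃ p m, M ≤ p ∧ R p m ∧ t * p < m := by
  obtain ⟨x, hx, y, hy, h⟩ := h
  have hQ' : (0 : ℝ) < Q := by exact_mod_cast hQ
  have hD' : (0 : ℝ) < D₁ := by exact_mod_cast hD₁
  have e' : (Q : ℝ) * D₂ = P * D₁ := by exact_mod_cast e
  have hδ : 0 < (D₂ : ℝ) - t * D₁ := by
    have : (D₂ : ℝ) = (P : ℝ) / Q * D₁ := by field_simp; linarith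
    rw [this]
    nlinarith
  obtain ⟨n, hn⟩ := exists_nat_gt (t * x / ((D₂ : ℝ) - t * D₁))
  rw [div_lt_iff₀ hδ] at hn
  obtain ⟨c, hc, -, hR⟩ := h (n + M)
  refine ⟨_, _, ?_, hR, ?_⟩
  · nlinarith
  · have hc' : (n : ℝ) ≤ c := by exact_mod_cast (by omega : n ≤ c)
    have := mul_le_mul_of_nonneg_right hc' hδ.le
    have hy : (0 : ℝ) ≤ y := Nat.cast_nonneg _
    push_cast
    nlinarith

end Slopes

/-! ## The repetitions of an automatic sequence are recognized by an automaton -/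

/-- The prefix of length `p + m` of `a` has the period `p`. -/
def HasRepetition {Δ : Type*} (a : ℕ → Δ) (p m : ℕ) : Prop :=
  0 < p ∧ ∀ i < m, a i = a (i + p)

section Repetition

variable {S : Type*} (k : ℕ) (T : S → ℕ → S) (h : ℕ → S)

/-- The states reached after reading `i`, `i + p` and `i + p + 1`. -/
def tripleState (p i : ℕ) : S × S × S := (h i, h (i + p), h (i + p + 1))

/-- The states of an automaton that reads `p` and `m` in parallel. -/
def repetitionState (p m : ℕ) : Set (S × S × S) × (S × S × S) × Bool :=
  ({x | ∃ i < m, x = tripleState h p i}, tripleState h p m, decide (p = 0))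

/-- The state reached after the digit `c` with carry, from the states at `x` and `x + 1`. -/
def carryStep (s t : S) (c : ℕ) : S := if c < k then T s c else T t (c - k)

/-- The action on `tripleState h p i` of the digits `d` of `p` and `c` of `i`. -/
def tripleStep (c d : ℕ) (x : S × S × S) : S × S × S :=
  (T x.1 c, carryStep k T x.2.1 x.2.2 (c + d), carryStep k T x.2.1 x.2.2 (c + d + 1))

variable {k T h}

theorem apply_mul_add_eq_carryStep (hT : ∀ n, ∀ d < k, h (k * n + d) = T (h n) d) {c : ℕ}
    (hc : c < 2 * k) (n : ℕ) : h (k * n + c) = carryStep k T (h n) (h (n + 1)) c := by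
  unfold carryStep
  split_ifs with hck
  · exact hT n c hck
  · rw [← hT _ _ (by omega)]
    congr 1
    rw [mul_add]
    omega

/-- The digit sum `c + d` may carry, which requires the state at `i + p + 1`. As `c + d + 1 < 2 *
k`, a second carry never occurs, so the triples are closed under reading digits. -/
theorem tripleState_mul_add (hT : ∀ n, ∀ d < k, h (k * n + d) = T (h n) d) {c d : ℕ}
    (hc : c < k) (hd : d < k) (p i : ℕ) :
    tripleState h (k * p + d) (k * i + c) = tripleStep k T c d (tripleState h p i) := by
  have e : k * i + c + (k * p + d) = k * (i + p) + (c + d) := by ring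
  unfold tripleState tripleStep
  rw [e, add_assoc (k * (i + p)), hT i c hc, apply_mul_add_eq_carryStep hT (by omega),
    apply_mul_add_eq_carryStep hT (by omega)]

/-- An index below `k * m + e` extends some `i < m` by any digit, or `m` itself by a digit below
`e`. This is why the state also records the triple at `m`. -/
theorem setOf_tripleState_mul_add (hT : ∀ n, ∀ d < k, h (k * n + d) = T (h n) d) {d e : ℕ}
    (hd : d < k) (he : e < k) (p m : ℕ) :
    {x | ∃ i < k * m + e, x = tripleState h (k * p + d) i} =
      {x | ∃ c < k, ∃ y ∈ {x | ∃ i < m, x = tripleState h p i}, x = tripleStep k T c d y} ∪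
        {x | ∃ c < e, x = tripleStep k T c d (tripleState h p m)} := by
  ext x
  simp only [Set.mem_ofPred_eq, Set.mem_union]
  constructor
  · rintro ⟨i, hi, rfl⟩
    have hc := Nat.mod_lt i (show 0 < k by omega)
    have e1 := Nat.div_add_mod i k
    rw [← e1, tripleState_mul_add hT hc hd]
    rcases lt_or_ge (i / k) m with h1 | h1
    · exact Or.inl ⟨_, hc, _, ⟨_, h1, rfl⟩, rfl⟩
    · have h2 : i / k = m := by
        refine le_antisymm (Nat.lt_succ_iff.1 (Nat.div_lt_of_lt_mul ?_)) h1
        rw [Nat.mul_succ]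
        omega
      rw [h2] at e1 ⊢
      exact Or.inr ⟨_, by omega, rfl⟩
  · rintro (⟨c, hc, _, ⟨i, hi, rfl⟩, rfl⟩ | ⟨c, hc, rfl⟩)
    · refine ⟨k * i + c, ?_, (tripleState_mul_add hT hc hd _ _).symm⟩
      have := Nat.mul_le_mul_left k (Nat.succ_le_of_lt hi)
      rw [Nat.mul_succ] at this
      omega
    · exact ⟨k * m + c, by omega, (tripleState_mul_add hT (by omega) hd _ _).symm⟩

theorem isDigitwise_repetitionState (hT : ∀ n, ∀ d < k, h (k * n + d) = T (h n) d) :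
    IsDigitwise k (repetitionState h) := by
  intro p m p' m' hE d hd e he
  simp only [repetitionState, Prod.mk.injEq, decide_eq_decide] at hE ⊢
  obtain ⟨h1, h2, h3⟩ := hE
  refine ⟨?_, ?_, ?_⟩
  · rw [setOf_tripleState_mul_add hT hd he, setOf_tripleState_mul_add hT hd he, h1, h2]
  · rw [tripleState_mul_add hT he hd, tripleState_mul_add hT he hd, h2]
  · have : k ≠ 0 := by omega
    simp [this, h3]

theorem hasRepetition_of_repetitionState_eq {Δ : Type*} {a : ℕ → Δ} {g : S → Δ}
    (hg : ∀ n, a n = g (h n)) (p m p' m' : ℕ) (hE : repetitionState h p m = repetitionState h p' m')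
    (hr : HasRepetition a p m) : HasRepetition a p' m' := by
  simp only [repetitionState, Prod.mk.injEq, decide_eq_decide] at hE
  obtain ⟨h1, -, h3⟩ := hE
  refine ⟨?_, fun i hi => ?_⟩
  · have := hr.1
    omega
  · have hmem : tripleState h p' i ∈ {x | ∃ i < m', x = tripleState h p' i} := ⟨i, hi, rfl⟩
    rw [← h1] at hmem
    obtain ⟨j, hj, e⟩ := hmem
    simp only [tripleState, Prod.mk.injEq] at e
    rw [hg, hg, e.1, e.2.1, ← hg, ← hg]
    exact hr.2 j hj

end Repetition

/-- The bound for the pumping lemma for the repetitions of a sequence generated by an automaton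
with `n` states. -/
def pumpingBound (k n : ℕ) : ℕ := k ^ (2 ^ ((n + 1) ^ 3) * ((n + 1) ^ 3 * 2))

theorem isPumpable_hasRepetition {S Δ : Type*} [Finite S] {k n : ℕ} {T : S → ℕ → S} {h : ℕ → S}
    {g : S → Δ} {a : ℕ → Δ} (hk : 2 ≤ k) (hT : ∀ n, ∀ d < k, h (k * n + d) = T (h n) d)
    (hg : ∀ n, a n = g (h n)) (hn : Nat.card S = n + 1) :
    IsPumpable (pumpingBound k n) (HasRepetition a) := by
  have := (isDigitwise_repetitionState hT).isPumpable hk (hasRepetition_of_repetitionState_eq hg)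
  have e : Nat.card (Set (S × S × S) × (S × S × S) × Bool)
      = 2 ^ ((n + 1) ^ 3) * ((n + 1) ^ 3 * 2) := by
    have := Fintype.ofFinite S
    classical
    rw [Nat.card_prod, Nat.card_prod, Nat.card_eq_fintype_card (α := Set _), Fintype.card_set,
      ← Nat.card_eq_fintype_card, Nat.card_prod, Nat.card_prod, hn, Nat.card_eq_fintype_card,
      Fintype.card_bool]
    ring
  rwa [e] at this

theorem baseValue_eq_foldl_map {k : ℕ} (w : List (Fin k)) :
    baseValue w = (w.map Fin.val).foldl (fun v d => k * v + d) 0 := by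
  rw [baseValue]
  congr 1
  simp [List.map_eq_flatMap]

/-! ### Automata reading integers -/

namespace DFAO

variable {k : ℕ} {σ Δ : Type*} (M : DFAO k σ Δ)

/-- The state reached on reading the canonical encoding of `n`. -/
def state (n : ℕ) : σ :=
  (Nat.digits k n).foldr (fun d s => if hd : d < k then M.step s ⟨d, hd⟩ else s) M.start

theorem state_zero : M.state 0 = M.start := by simp [state]

theorem state_of_pos (hk : 2 ≤ k) {n : ℕ} (hn : 0 < n) :
    M.state n = M.step (M.state (n / k)) ⟨n % k, Nat.mod_lt _ (by omega)⟩ := by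
  rw [state, Nat.digits_def' (by omega) hn, List.foldr_cons,
    dif_pos (Nat.mod_lt _ (by omega : 0 < k))]
  rfl

theorem exists_canonical (hk : 2 ≤ k) (n : ℕ) :
    ∃ w : List (Fin k), IsCanonical w ∧ baseValue w = n ∧ w.foldl M.step M.start = M.state n := by
  induction n using Nat.strong_induction_on with
  | _ n ih =>
    rcases Nat.eq_zero_or_pos n with rfl | hn
    · exact ⟨[], by simp [IsCanonical], rfl, (M.state_zero).symm⟩
    · obtain ⟨w, hw, hv, hs⟩ := ih (n / k) (Nat.div_lt_self hn (by omega))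
      have hmod : n % k < k := Nat.mod_lt _ (by omega)
      refine ⟨w ++ [⟨n % k, hmod⟩], ?_, ?_, ?_⟩
      · cases w with
        | nil =>
          have h0 : n / k = 0 := hv.symm
          have := Nat.div_add_mod n k
          rw [h0] at this
          simp only [IsCanonical, List.nil_append, List.head?_cons, Option.mem_some_iff]
          rintro d rfl
          simp only
          omega
        | cons b w => simpa [IsCanonical] using hw
      · simp only [baseValue_eq_foldl_map, List.map_append, List.foldl_append] at hv ⊢
        rw [hv]
        exact Nat.div_add_mod n k
      · rw [List.foldl_append, hs, M.state_of_pos hk hn]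
        rfl

variable {M}

theorem Generates.eq_out_state {a : ℕ → Δ} (h : M.Generates a) (hk : 2 ≤ k) (n : ℕ) :
    a n = M.out (M.state n) := by
  obtain ⟨w, hw, hv, hs⟩ := M.exists_canonical hk n
  rw [← hv, ← h w hw, eval, hs, hv]

theorem Generates.isPumpable {a : ℕ → Δ} [Finite σ] (h : M.Generates a) (hk : 2 ≤ k) :
    IsPumpable (pumpingBound k (Nat.card σ)) (HasRepetition a) := by
  -- The automaton may leave its initial state on a leading zero. The extra state `none` stands for
  -- the integer `0` and absorbs leading zeros.
  refine isPumpable_hasRepetition (S := Option σ)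
    (T := fun o d => if hd : d < k then o.elim (if d = 0 then none else some (M.step M.start ⟨d, hd⟩))
      (fun s => some (M.step s ⟨d, hd⟩)) else none)
    (h := fun n => if n = 0 then none else some (M.state n))
    (g := fun o => o.elim (M.out M.start) M.out) hk ?_ ?_ ?_
  · intro n d hd
    rcases Nat.eq_zero_or_pos (k * n + d) with h0 | h0
    · have hn : n = 0 := by
        rcases Nat.eq_zero_or_pos n with h | h
        · exact h
        · have := Nat.mul_pos (show 0 < k by omega) h
          omega
      have hd0 : d = 0 := by omega
      subst hn hd0
      simp
    · have h1 : (k * n + d) / k = n := by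
        rw [Nat.mul_add_div (by omega), Nat.div_eq_of_lt hd, add_zero]
      have h2 : (k * n + d) % k = d := by
        rw [Nat.mul_add_mod, Nat.mod_eq_of_lt hd]
      have h3 : M.state (k * n + d) = M.step (M.state n) ⟨d, hd⟩ := by
        rw [M.state_of_pos hk h0]
        congr 1
        · rw [h1]
        · exact Fin.ext h2
      rw [if_neg (by omega), dif_pos hd, h3]
      rcases Nat.eq_zero_or_pos n with rfl | hn
      · rw [if_pos rfl, state_zero]
        simp only [Option.elim_none]
        rw [if_neg (by omega)]
      · rw [if_neg (by omega)]
        rfl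
  · intro n
    rw [h.eq_out_state hk]
    rcases Nat.eq_zero_or_pos n with rfl | hn
    · simp [state_zero]
    · simp [hn.ne']
  · exact Finite.card_option

end DFAO

/-! ## Initial critical exponents in terms of repetitions -/

section Exponents

variable {Δ : Type*}

theorem hasRepetition_iff {a : ℕ → Δ} {p m : ℕ} (hp : 0 < p) :
    HasRepetition a p m ↔ ∀ i < p + m, a i = a (i % p) := by
  constructor
  · intro h i
    induction i using Nat.strong_induction_on with
    | _ i ih =>
      intro hi
      rcases lt_or_ge i p with h1 | h1
      · rw [Nat.mod_eq_of_lt h1]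
      · obtain ⟨j, rfl⟩ := Nat.exists_eq_add_of_le' h1
        rw [← h.2 j (by omega), Nat.add_mod_right]
        exact ih j (by omega) (by omega)
  · intro h
    refine ⟨hp, fun i hi => ?_⟩
    rw [h i (by omega), h (i + p) (by omega), Nat.add_mod_right]

theorem isPrefixOf_iff {a : ℕ → Δ} {w : List Δ} :
    IsPrefixOf w a ↔ ∀ i < w.length, w[i]? = some (a i) := by
  constructor
  · intro h i hi
    rw [h]
    simp [hi]
  · intro h
    refine List.ext_getElem? fun i => ?_
    rcases lt_or_ge i w.length with hi | hi
    · rw [h i hi]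
      simp [hi]
    · simp [hi]

theorem isPrefixOf_map_range (a : ℕ → Δ) (n : ℕ) : IsPrefixOf ((List.range n).map a) a := by
  simp [IsPrefixOf]

theorem length_flatten_replicate (n : ℕ) (x : List Δ) :
    (List.replicate n x).flatten.length = n * x.length := by
  simp

theorem getElem?_flatten_replicate_append {x x' : List Δ} (hx : x' <+: x) (n : ℕ) :
    ∀ i < n * x.length + x'.length,
      ((List.replicate n x).flatten ++ x')[i]? = x[i % x.length]? := by
  induction n with
  | zero =>
    intro i hi
    have hi' : i < x'.length := by simpa using hi
    rw [Nat.mod_eq_of_lt (hi'.trans_le hx.length_le)]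
    obtain ⟨t, rfl⟩ := hx
    simp [List.getElem?_append_left hi']
  | succ n ih =>
    intro i hi
    rw [List.replicate_succ, List.flatten_cons, List.append_assoc]
    rcases lt_or_ge i x.length with h1 | h1
    · rw [List.getElem?_append_left h1, Nat.mod_eq_of_lt h1]
    · rw [List.getElem?_append_right h1, ih _ (by rw [Nat.succ_mul] at hi; omega),
        ← Nat.mod_eq_sub_mod h1]

theorem IsPeriodOf.hasRepetition {a : ℕ → Δ} {x w : List Δ} (h : IsPeriodOf x w)
    (hw : IsPrefixOf w a) : x.length ≤ w.length ∧
      HasRepetition a x.length (w.length - x.length) := by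
  obtain ⟨hx, n, hn, x', hx', e⟩ := h
  have hlen : w.length = n * x.length + x'.length := by simp [e]
  have hle : x.length ≤ w.length := by nlinarith
  have hpos : 0 < x.length := List.length_pos_iff.2 hx
  have key : ∀ i < w.length, some (a i) = x[i % x.length]? := by
    intro i hi
    rw [← isPrefixOf_iff.1 hw i hi]
    conv_lhs => rw [e]
    exact getElem?_flatten_replicate_append hx' n i (by omega)
  refine ⟨hle, (hasRepetition_iff hpos).2 fun i hi => Option.some_injective _ ?_⟩
  rw [key i (by omega), key _ ((Nat.mod_lt _ hpos).trans_le hle), Nat.mod_mod]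

theorem HasRepetition.isPeriodOf {a : ℕ → Δ} {p m : ℕ} (h : HasRepetition a p m) :
    IsPeriodOf ((List.range p).map a) ((List.range (p + m)).map a) := by
  have hp := h.1
  have hmod := Nat.mod_lt (p + m) hp
  have hx' : (List.range ((p + m) % p)).map a <+: (List.range p).map a := by
    obtain ⟨r, hr⟩ := Nat.exists_eq_add_of_le hmod.le
    conv_rhs => rw [hr, List.range_add, List.map_append]
    exact List.prefix_append _ _
  refine ⟨by simpa using hp.ne', (p + m) / p, Nat.div_pos (by omega) hp, _, hx', ?_⟩
  have hlen := Nat.div_add_mod' (p + m) p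
  refine List.ext_getElem? fun i => ?_
  rcases lt_or_ge i (p + m) with hi | hi
  · rw [getElem?_flatten_replicate_append hx' _ i
      (by simp only [List.length_map, List.length_range]; omega)]
    simp [hi, Nat.mod_lt i hp, (hasRepetition_iff hp).1 h i hi]
  · rw [List.getElem?_eq_none (by simpa using hi), List.getElem?_eq_none]
    rw [List.length_append, length_flatten_replicate]
    simp only [List.length_map, List.length_range]
    omega

theorem exists_isPeriodOf_length_eq_minPeriod {w : List Δ} (hw : w ≠ []) :
    ∃ x, IsPeriodOf x w ∧ x.length = minPeriod w :=
  Nat.sInf_mem (s := {p : ℕ | ∃ x : List Δ, IsPeriodOf x w ∧ x.length = p})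
    ⟨w.length, w, ⟨hw, 1, le_rfl, [], List.nil_prefix, by simp⟩, rfl⟩

theorem exists_exponent_eq {a : ℕ → Δ} {w : List Δ} (hw : w ≠ []) (h : IsPrefixOf w a) :
    ∃ p m, HasRepetition a p m ∧ exponent w = 1 + (m : ℝ) / p := by
  obtain ⟨x, hx, e⟩ := exists_isPeriodOf_length_eq_minPeriod hw
  obtain ⟨hle, hr⟩ := hx.hasRepetition h
  refine ⟨_, _, hr, ?_⟩
  have : (x.length : ℝ) ≠ 0 := by exact_mod_cast hr.1.ne'
  rw [exponent, ← e, Nat.cast_sub hle]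
  field_simp
  ring

/-- Since `p` need not be the shortest period, there is only an inequality; it suffices for a
supremum. -/
theorem HasRepetition.exists_le_exponent {a : ℕ → Δ} {p m : ℕ} (h : HasRepetition a p m) :
    ∃ w : List Δ, w ≠ [] ∧ IsPrefixOf w a ∧ 1 + (m : ℝ) / p ≤ exponent w := by
  have hp := h.1
  have hw : (List.range (p + m)).map a ≠ [] := by
    simp only [ne_eq, List.map_eq_nil_iff, List.range_eq_nil]
    omega
  refine ⟨_, hw, isPrefixOf_map_range _ _, ?_⟩
  have h1 : minPeriod ((List.range (p + m)).map a) ≤ p :=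
    Nat.sInf_le ⟨_, h.isPeriodOf, by simp⟩
  obtain ⟨x, hx, e⟩ := exists_isPeriodOf_length_eq_minPeriod hw
  have h2 : 0 < minPeriod ((List.range (p + m)).map a) := by
    rw [← e]
    exact List.length_pos_iff.2 hx.1
  have hp' : (p : ℝ) ≠ 0 := by exact_mod_cast hp.ne'
  have e' : 1 + (m : ℝ) / p = ((p + m : ℕ) : ℝ) / p := by
    push_cast
    field_simp
  rw [e', exponent, List.length_map, List.length_range]
  gcongr

theorem length_realPow {x : List Δ} {β : ℝ} :
    (realPow x β).length = ⌈β * (x.length : ℝ)⌉₊ := by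
  rw [realPow, List.length_take, length_flatten_replicate]
  refine min_eq_left (Nat.ceil_le.2 ?_)
  push_cast
  gcongr
  exact Nat.le_ceil β

theorem getElem?_realPow {x : List Δ} {β : ℝ} {i : ℕ} (hi : i < (realPow x β).length) :
    (realPow x β)[i]? = x[i % x.length]? := by
  have hi' : i < ⌈β * (x.length : ℝ)⌉₊ := by rwa [length_realPow] at hi
  have h2 : i < ⌈β⌉₊ * x.length := by
    rw [realPow, List.length_take, length_flatten_replicate] at hi
    exact hi.trans_le (min_le_right _ _)
  rw [realPow, List.getElem?_take_of_lt hi']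
  have := getElem?_flatten_replicate_append (List.nil_prefix (l := x)) ⌈β⌉₊ i (by simpa using h2)
  rwa [List.append_nil] at this

theorem exists_hasRepetition_of_realPow {a : ℕ → Δ} {w : List Δ} {β : ℝ} (hβ : 1 ≤ β)
    (hw : 0 < w.length) (h : IsPrefixOf (realPow w β) a) :
    ∃ m, HasRepetition a w.length m ∧ β * w.length ≤ w.length + m := by
  have hlen := length_realPow (x := w) (β := β)
  have hle : w.length ≤ (realPow w β).length := by
    have h1 := Nat.le_ceil (β * (w.length : ℝ))
    have h2 : (0 : ℝ) < w.length := by exact_mod_cast hw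
    rw [hlen]
    exact_mod_cast (show (w.length : ℝ) ≤ ⌈β * (w.length : ℝ)⌉₊ by nlinarith)
  have key : ∀ i < (realPow w β).length, some (a i) = w[i % w.length]? := by
    intro i hi
    rw [← isPrefixOf_iff.1 h i hi, getElem?_realPow hi]
  refine ⟨(realPow w β).length - w.length, (hasRepetition_iff hw).2 fun i hi =>
    Option.some_injective _ ?_, ?_⟩
  · rw [key i (by omega), key _ ((Nat.mod_lt _ hw).trans_le hle), Nat.mod_mod]
  · rw [Nat.cast_sub hle, hlen]
    have := Nat.le_ceil (β * (w.length : ℝ))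
    linarith

theorem HasRepetition.isPrefixOf_realPow {a : ℕ → Δ} {p m : ℕ} (h : HasRepetition a p m) {β : ℝ}
    (hβ : β * p ≤ p + m) : IsPrefixOf (realPow ((List.range p).map a) β) a := by
  have hp := h.1
  rw [isPrefixOf_iff]
  intro i hi
  rw [getElem?_realPow hi]
  have hi' : i < p + m := by
    rw [length_realPow] at hi
    refine hi.trans_le (Nat.ceil_le.2 ?_)
    simpa using hβ
  simp [Nat.mod_lt i hp, (hasRepetition_iff hp).1 h i hi']

theorem HasRepetition.le_ice₁ {a : ℕ → Δ} {p m : ℕ} (h : HasRepetition a p m) {t : ℝ}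
    (ht : t * p ≤ m) : ((1 + t : ℝ) : EReal) ≤ ice₁ a := by
  obtain ⟨w, hw, hwa, hle⟩ := h.exists_le_exponent
  have hp : (0 : ℝ) < p := by exact_mod_cast h.1
  refine le_trans (EReal.coe_le_coe_iff.2 ?_) (le_sSup ⟨w, hw, hwa, rfl⟩)
  have : t ≤ m / p := by rwa [le_div_iff₀ hp]
  linarith

theorem le_ice₂ {a : ℕ → Δ} {t : ℝ} (ht0 : 0 ≤ t)
    (ht : ∀ M, ∃ p m, M ≤ p ∧ HasRepetition a p m ∧ t * p ≤ m) :
    ((1 + t : ℝ) : EReal) ≤ ice₂ a := by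
  refine le_sSup ⟨1 + t, rfl, by linarith, fun M _ => ?_⟩
  obtain ⟨p, m, hM, hr, hle⟩ := ht M
  exact ⟨(List.range p).map a, by simpa using hM, hr.isPrefixOf_realPow (by linarith)⟩

theorem ice₁_eq_top {a : ℕ → Δ} (h : ∀ t : ℝ, ∃ p m, HasRepetition a p m ∧ t * p ≤ m) :
    ice₁ a = ⊤ := by
  refine (EReal.eq_top_iff_forall_lt _).2 fun y => ?_
  obtain ⟨p, m, hr, hle⟩ := h y
  exact lt_of_lt_of_le (EReal.coe_lt_coe_iff.2 (by linarith)) (hr.le_ice₁ hle)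

theorem ice₂_eq_top {a : ℕ → Δ}
    (h : ∀ (t : ℝ) (M : ℕ), ∃ p m, M ≤ p ∧ HasRepetition a p m ∧ t * p ≤ m) : ice₂ a = ⊤ := by
  refine (EReal.eq_top_iff_forall_lt _).2 fun y => ?_
  refine lt_of_lt_of_le (EReal.coe_lt_coe_iff.2 ?_) (le_ice₂ (le_max_left 0 y) (h _))
  have := le_max_right 0 y
  linarith

theorem ice₁_eq {a : ℕ → Δ} {s : ℝ} (hle : ∀ p m, HasRepetition a p m → (m : ℝ) ≤ s * p)
    (hge : ∀ t < s, ∃ p m, HasRepetition a p m ∧ t * p ≤ m) : ice₁ a = ((1 + s : ℝ) : EReal) := by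
  refine le_antisymm (sSup_le ?_) ?_
  · rintro _ ⟨w, hw, hwa, rfl⟩
    obtain ⟨p, m, hr, e⟩ := exists_exponent_eq hw hwa
    have hp : (0 : ℝ) < p := by exact_mod_cast hr.1
    rw [e, EReal.coe_le_coe_iff, add_le_add_iff_left, div_le_iff₀ hp]
    exact hle p m hr
  · by_contra! hlt
    obtain ⟨b, hb, hbs⟩ := EReal.lt_iff_exists_real_btwn.1 hlt
    rw [EReal.coe_lt_coe_iff] at hbs
    obtain ⟨p, m, hr, h⟩ := hge (b - 1) (by linarith)
    have := hr.le_ice₁ h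
    rw [add_sub_cancel] at this
    exact absurd hb this.not_gt

theorem ice₂_eq {a : ℕ → Δ} {s C : ℝ} (hle : ∀ p m, HasRepetition a p m → (m : ℝ) ≤ C + s * p)
    (hge : ∀ t < s, ∀ M, ∃ p m, M ≤ p ∧ HasRepetition a p m ∧ t * p ≤ m) :
    ice₂ a = ((1 + s : ℝ) : EReal) := by
  refine le_antisymm (sSup_le ?_) ?_
  · rintro _ ⟨β, rfl, hβ, h⟩
    rw [EReal.coe_le_coe_iff]
    by_contra! hlt
    have hδ : 0 < β - (1 + s) := by linarith
    -- Beyond this length the constant `C` can no longer make up for the excess of `β` over `1 + s`.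
    obtain ⟨M, hM⟩ := exists_nat_gt (C / (β - (1 + s)))
    rw [div_lt_iff₀ hδ] at hM
    obtain ⟨w, hw, hpre⟩ := h (M + 1) (by omega)
    obtain ⟨m, hr, hβm⟩ := exists_hasRepetition_of_realPow hβ (by omega) hpre
    have h1 := hle _ _ hr
    have h2 : (M : ℝ) ≤ w.length := by exact_mod_cast (by omega : M ≤ w.length)
    nlinarith
  -- Only `β ≥ 1` is admitted in `ice₂`, so `b` must be known to be at least `1`; the trivial
  -- repetitions `m = 0` provide this.
  · have hone : ((1 : ℝ) : EReal) ≤ ice₂ a := by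
      have := le_ice₂ (a := a) le_rfl fun M => ⟨M + 1, 0, by omega, ⟨by omega, by simp⟩, by simp⟩
      rwa [add_zero] at this
    by_contra! hlt
    obtain ⟨b, hb, hbs⟩ := EReal.lt_iff_exists_real_btwn.1 hlt
    have hb1 := EReal.coe_lt_coe_iff.1 (hone.trans_lt hb)
    rw [EReal.coe_lt_coe_iff] at hbs
    have := le_ice₂ (a := a) (t := b - 1) (by linarith) (hge (b - 1) (by linarith))
    rw [add_sub_cancel] at this
    exact absurd hb this.not_gt

end Exponents

/-! ## The initial critical exponents are found by looking at small repetitions -/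

/-- `R` has a small element of slope at least `N`. -/
def IsSteep (N : ℕ) (R : ℕ → ℕ → Prop) : Prop :=
  ∃ p < N ^ 2, ∃ m < N ^ 2 + (2 * N) ^ (N ^ 3 + 1) * N, R p m ∧ N * p ≤ m

open Classical in
/-- One plus the largest slope of elements of `R` with `K ≤ p`, as far as small elements tell. -/
noncomputable def searchExponent (N K : ℕ) (R : ℕ → ℕ → Prop) : Option (ℕ × ℕ) :=
  if IsSteep N R then none
  else some (N.factorial + Nat.findGreatest (HasSlope N K R) (N * N.factorial), N.factorial)

section Search

variable {Δ : Type*} {a : ℕ → Δ}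

theorem HasRepetition.mono {p m m' : ℕ} (h : HasRepetition a p m) (hm : m' ≤ m) :
    HasRepetition a p m' :=
  ⟨h.1, fun i hi => h.2 i (hi.trans_le hm)⟩

/-- A vertical direction yields a single period, whereas `ice₂` asks for arbitrarily long ones: its
multiples. -/
theorem hasRepetition_mul {p : ℕ} (h : ∀ m, HasRepetition a p m) {j : ℕ} (hj : 0 < j) (m : ℕ) :
    HasRepetition a (j * p) m := by
  refine ⟨Nat.mul_pos hj (h 0).1, fun i _ => ?_⟩
  clear hj
  induction j with
  | zero => simp
  | succ j ih =>
    rw [ih, (h (i + j * p + 1)).2 (i + j * p) (Nat.lt_succ_self _)]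
    congr 1
    ring

theorem exists_hasRepetition_of_periodic {p : ℕ} (h : ∀ m, HasRepetition a p m) (t : ℝ) (M : ℕ) :
    ∃ p m, M ≤ p ∧ HasRepetition a p m ∧ t * p ≤ m := by
  obtain ⟨m, hm⟩ := exists_nat_ge (t * ((M + 1) * p : ℕ))
  refine ⟨(M + 1) * p, m, ?_, hasRepetition_mul h (Nat.succ_pos _) m, hm⟩
  have := (h 0).1
  nlinarith

theorem denotes_searchExponent {N : ℕ} (hR : IsPumpable N (HasRepetition a)) :
    Denotes (searchExponent N 0 (HasRepetition a)) (ice₁ a) ∧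
      Denotes (searchExponent N (2 * (N.factorial * N)) (HasRepetition a)) (ice₂ a) := by
  have hpos : ∀ p m, HasRepetition a p m → 0 < p := fun p m h => h.1
  by_cases hD : ∃ D, 0 < D ∧ D < N ∧ IsDirection N (HasRepetition a) 0 D
  · obtain ⟨D, h0, hN, hD⟩ := hD
    have hs : IsSteep N (HasRepetition a) := hD.exists_steep h0 hN
    obtain ⟨p, hp⟩ := hD.exists_unbounded h0
    have hper : ∀ m, HasRepetition a p m := fun m => by
      obtain ⟨m', hm, hr⟩ := hp m
      exact hr.mono hm
    rw [searchExponent, searchExponent, if_pos hs, if_pos hs]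
    refine ⟨ice₁_eq_top fun t => ?_, ice₂_eq_top (exists_hasRepetition_of_periodic hper)⟩
    obtain ⟨p, m, -, h⟩ := exists_hasRepetition_of_periodic hper t 0
    exact ⟨p, m, h⟩
  · have hdir : ∀ D, 0 < D → D < N → ¬ IsDirection N (HasRepetition a) 0 D :=
      fun D h0 hN h => hD ⟨D, h0, hN, h⟩
    have hs : ¬ IsSteep N (HasRepetition a) := by
      rintro ⟨p, -, m, -, hpm, hle⟩
      exact absurd (hR.lt_mul hpos hdir hpm) hle.not_gt
    have hne : ∃ p, N ≤ p ∧ ∃ m, HasRepetition a p m :=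
      ⟨N + 1, Nat.le_succ _, 0, Nat.succ_pos _, by simp⟩
    have hQ := N.factorial_pos
    have hQ' : (0 : ℝ) < N.factorial := by exact_mod_cast hQ
    have hval : ∀ P : ℕ, (((N.factorial + P : ℕ) : ℝ) / (N.factorial : ℕ)) =
        1 + (P : ℝ) / N.factorial := by
      intro P
      push_cast
      field_simp
    rw [searchExponent, searchExponent, if_neg hs, if_neg hs]
    refine ⟨⟨hQ.ne', ?_⟩, ⟨hQ.ne', ?_⟩⟩
    · obtain ⟨P, hP, hatt⟩ := hR.exists_sup hpos hdir hne
      rw [findGreatest_hasSlope hatt (Nat.zero_le _) hpos fun p m _ h => by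
        have := hP p m h
        nlinarith, hval]
      refine ice₁_eq (fun p m h => ?_) fun t ht => ?_
      · have : (N.factorial : ℝ) * m ≤ P * p := by exact_mod_cast hP p m h
        rw [div_mul_eq_mul_div, le_div_iff₀ hQ']
        linarith
      · obtain ⟨D₁, -, D₂, -, hD₁, hdr, e⟩ | ⟨p, -, m, -, -, hp, hpm, e⟩ := hatt
        · obtain ⟨p, m, -, hr, hlt⟩ := hdr.exists_slope_gt hD₁ hQ e ht 0
          exact ⟨p, m, hr, hlt.le⟩
        · refine ⟨p, m, hpm, ?_⟩
          have e' : (N.factorial : ℝ) * m = P * p := by exact_mod_cast e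
          have : (m : ℝ) = (P : ℝ) / N.factorial * p := by
            field_simp
            linarith
          rw [this]
          gcongr
    · obtain ⟨P, hP, hatt, D₁, -, D₂, -, hD₁, hdr, e⟩ :=
        hR.exists_limsup hdir hne (2 * (N.factorial * N))
      -- The choice of `K` makes twice the additive error `N! * N` at most `p`.
      rw [findGreatest_hasSlope hatt le_rfl hpos fun p m hK h => by
        have := hP p m h
        nlinarith, hval]
      refine ice₂_eq (C := N) (fun p m h => ?_) fun t ht M => ?_
      · have : (N.factorial : ℝ) * m ≤ N.factorial * N + P * p := by exact_mod_cast hP p m h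
        rw [div_mul_eq_mul_div, ← sub_le_iff_le_add', le_div_iff₀ hQ']
        linarith
      · obtain ⟨p, m, hM, hr, hlt⟩ := hdr.exists_slope_gt hD₁ hQ e ht M
        exact ⟨p, m, hM, hr, hlt.le⟩

end Search

theorem Denotes.rationalOrInfinite {r : Option (ℕ × ℕ)} {α : EReal} (h : Denotes r α) :
    RationalOrInfinite α := by
  match r, h with
  | none, h => exact Or.inl h
  | some (p, q), h => exact Or.inr ⟨(p : ℚ) / q, by rw [h.2]; push_cast; rfl⟩

/-! ## Computability -/

theorem primrec₂_nat_pow : Primrec₂ ((· ^ ·) : ℕ → ℕ → ℕ) :=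
  Primrec₂.unpaired'.1 Nat.Primrec.pow

theorem primrec_factorial : Primrec Nat.factorial := by
  refine (Primrec.nat_rec₁ (f := fun n r => (n + 1) * r) 1
    (Primrec.nat_mul.comp (Primrec.succ.comp Primrec.fst) Primrec.snd)).of_eq fun n => ?_
  induction n with
  | zero => rfl
  | succ n ih => exact congrArg ((n + 1) * ·) ih

section Bounded

variable {α : Type*} [Primcodable α] {b : α → ℕ} {p : α → ℕ → Prop}

theorem primrecPred_exists_lt (hb : Primrec b) (hp : PrimrecRel p) :
    PrimrecPred fun a => ∃ x < b a, p a x :=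
  ((PrimrecRel.exists_mem_list (R := fun x a => p a x) (hp.comp₂ Primrec₂.right
    Primrec₂.left)).comp (Primrec.list_range.comp hb) Primrec.id).of_eq fun a => by simp

theorem primrecPred_forall_lt (hb : Primrec b) (hp : PrimrecRel p) :
    PrimrecPred fun a => ∀ x < b a, p a x :=
  ((PrimrecRel.forall_mem_list (R := fun x a => p a x) (hp.comp₂ Primrec₂.right
    Primrec₂.left)).comp (Primrec.list_range.comp hb) Primrec.id).of_eq fun a => by simp

end Bounded

/-- The state reached on reading `n` by the automaton described by `c`. -/
def codeState (c : DFAOCode) (n : ℕ) : ℕ :=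
  if n = 0 then c.2.1
  else if _ : n / c.1 < n then (c.2.2.1.getD (codeState c (n / c.1)) []).getD (n % c.1) 0
  else (c.2.2.1.getD 0 []).getD (n % c.1) 0
termination_by n

/-- The sequence generated by the automaton described by `c`. -/
def codeSeq (c : DFAOCode) (n : ℕ) : ℕ := c.2.2.2.getD (codeState c n) 0

theorem primrec₂_codeState : Primrec₂ codeState := by
  have hlen : Primrec fun x : DFAOCode × List ℕ => x.2.length :=
    Primrec.list_length.comp Primrec.snd
  have hk : Primrec fun x : DFAOCode × List ℕ => x.1.1 := Primrec.fst.comp Primrec.fst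
  have hs : Primrec fun x : DFAOCode × List ℕ => x.1.2.1 :=
    Primrec.fst.comp (Primrec.snd.comp Primrec.fst)
  have ht : Primrec fun x : DFAOCode × List ℕ => x.1.2.2.1 :=
    Primrec.fst.comp (Primrec.snd.comp (Primrec.snd.comp Primrec.fst))
  have hrow : Primrec fun x : DFAOCode × List ℕ =>
      x.1.2.2.1.getD (x.2.getD (x.2.length / x.1.1) 0) [] :=
    (Primrec.list_getD []).comp ht
      ((Primrec.list_getD 0).comp Primrec.snd (Primrec.nat_div.comp hlen hk))
  have hentry := (Primrec.list_getD 0).comp hrow (Primrec.nat_mod.comp hlen hk)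
  -- The list `l` holds the states at all smaller integers. For base `1` the index `l.length / c.1`
  -- is out of range, and the default `0` matches the last branch of `codeState`.
  refine Primrec.nat_strong_rec codeState (g := fun c l => some (if l.length = 0 then c.2.1 else
    (c.2.2.1.getD (l.getD (l.length / c.1) 0) []).getD (l.length % c.1) 0))
    (Primrec.option_some.comp
      (Primrec.ite (Primrec.eq.comp hlen (Primrec.const 0)) hs hentry)) fun c n => ?_
  rw [codeState]
  simp only [List.length_map, List.length_range, dite_eq_ite]
  congr 1
  split_ifs with h1 h2
  · rfl
  · congr 2
    simp [h2]
  · congr 2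
    simp [Nat.le_of_not_lt h2]

theorem primrec₂_codeSeq : Primrec₂ codeSeq :=
  (Primrec.list_getD 0).comp
    (Primrec.snd.comp (Primrec.snd.comp (Primrec.snd.comp Primrec.fst))) primrec₂_codeState

theorem primrecPred_hasRepetition :
    PrimrecPred fun x : DFAOCode × ℕ × ℕ => HasRepetition (codeSeq x.1) x.2.1 x.2.2 := by
  have hp : Primrec fun x : DFAOCode × ℕ × ℕ => x.2.1 := Primrec.fst.comp Primrec.snd
  have hm : Primrec fun x : DFAOCode × ℕ × ℕ => x.2.2 := Primrec.snd.comp Primrec.snd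
  refine (Primrec.nat_lt.comp (Primrec.const 0) hp).and (primrecPred_forall_lt hm ?_)
  have hc : Primrec fun x : (DFAOCode × ℕ × ℕ) × ℕ => x.1.1 := Primrec.fst.comp Primrec.fst
  exact Primrec.eq.comp (primrec₂_codeSeq.comp hc Primrec.snd)
    (primrec₂_codeSeq.comp hc (Primrec.nat_add.comp Primrec.snd (hp.comp Primrec.fst)))

theorem primrec_witnessBound : Primrec witnessBound := by
  have hid : Primrec fun N : ℕ => N := Primrec.id
  have hc : ∀ n : ℕ, Primrec fun _ : ℕ => n := fun n => Primrec.const n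
  have hsq := primrec₂_nat_pow.comp hid (hc 2)
  have h2N := Primrec.nat_mul.comp (hc 2) hid
  have h1 := Primrec.nat_mul.comp (Primrec.nat_mul.comp (hc 2)
    (Primrec.nat_mul.comp hid primrec_factorial)) hsq
  have h2 := Primrec.nat_mul.comp (hc 2) (Primrec.nat_mul.comp primrec_factorial hid)
  exact Primrec.nat_add.comp hsq (Primrec.nat_mul.comp (primrec₂_nat_pow.comp h2N
    (Primrec.succ.comp (Primrec.succ.comp (Primrec.nat_add.comp h1 h2)))) hid)

section Search

variable {N K : DFAOCode → ℕ}

theorem primrecPred_isSteep (hN : Primrec N) :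
    PrimrecPred fun c : DFAOCode => IsSteep (N c) (HasRepetition (codeSeq c)) := by
  have hc : ∀ n : ℕ, Primrec fun _ : DFAOCode => n := fun n => Primrec.const n
  have hsq := primrec₂_nat_pow.comp hN (hc 2)
  have hb := Primrec.nat_add.comp hsq (Primrec.nat_mul.comp (primrec₂_nat_pow.comp
    (Primrec.nat_mul.comp (hc 2) hN)
    (Primrec.succ.comp (primrec₂_nat_pow.comp hN (hc 3)))) hN)
  refine primrecPred_exists_lt hsq (primrecPred_exists_lt (hb.comp Primrec.fst) ?_)
  have h1 : Primrec fun x : (DFAOCode × ℕ) × ℕ => x.1.1 := Primrec.fst.comp Primrec.fst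
  have h2 : Primrec fun x : (DFAOCode × ℕ) × ℕ => x.1.2 := Primrec.snd.comp Primrec.fst
  exact (primrecPred_hasRepetition.comp (h1.pair (h2.pair Primrec.snd))).and
    (Primrec.nat_le.comp (Primrec.nat_mul.comp (hN.comp h1) h2) Primrec.snd)

theorem primrecRel_hasSlope (hN : Primrec N) (hK : Primrec K) :
    PrimrecRel fun c : DFAOCode => HasSlope (N c) (K c) (HasRepetition (codeSeq c)) := by
  have hb : Primrec fun x : DFAOCode × ℕ => witnessBound (N x.1) :=
    primrec_witnessBound.comp (hN.comp Primrec.fst)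
  refine primrecPred_exists_lt hb (primrecPred_exists_lt (hb.comp Primrec.fst) ?_)
  have hc : Primrec fun x : ((DFAOCode × ℕ) × ℕ) × ℕ => x.1.1.1 :=
    Primrec.fst.comp (Primrec.fst.comp Primrec.fst)
  have hP : Primrec fun x : ((DFAOCode × ℕ) × ℕ) × ℕ => x.1.1.2 :=
    Primrec.snd.comp (Primrec.fst.comp Primrec.fst)
  have hp : Primrec fun x : ((DFAOCode × ℕ) × ℕ) × ℕ => x.1.2 := Primrec.snd.comp Primrec.fst
  have hm : Primrec fun x : ((DFAOCode × ℕ) × ℕ) × ℕ => x.2 := Primrec.snd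
  have h2 : Primrec fun _ : ((DFAOCode × ℕ) × ℕ) × ℕ => 2 := Primrec.const 2
  exact (Primrec.nat_le.comp (hK.comp hc) hp).and
    ((primrecPred_hasRepetition.comp (hc.pair (hp.pair hm))).and
      (Primrec.nat_lt.comp (Primrec.nat_mul.comp (Primrec.nat_mul.comp h2 hP) hp)
        (Primrec.nat_add.comp (Primrec.nat_mul.comp (Primrec.nat_mul.comp h2
          (primrec_factorial.comp (hN.comp hc))) hm) hp)))

theorem primrec_searchExponent (hN : Primrec N) (hK : Primrec K) :
    Primrec fun c : DFAOCode => searchExponent (N c) (K c) (HasRepetition (codeSeq c)) := by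
  classical
  have hQ := primrec_factorial.comp hN
  exact Primrec.ite (primrecPred_isSteep hN) (Primrec.const none)
    (Primrec.option_some.comp ((Primrec.nat_add.comp hQ
      (Primrec.nat_findGreatest (Primrec.nat_mul.comp hN hQ) (primrecRel_hasSlope hN hK))).pair hQ))

end Search

/-- The pumping bound of the automaton described by `c`. -/
def codeBound (c : DFAOCode) : ℕ := pumpingBound c.1 c.2.2.1.length

theorem primrec_codeBound : Primrec codeBound := by
  have hc : ∀ n : ℕ, Primrec fun _ : DFAOCode => n := fun n => Primrec.const n
  have hn : Primrec fun c : DFAOCode => c.2.2.1.length + 1 :=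
    Primrec.succ.comp (Primrec.list_length.comp
      (Primrec.fst.comp (Primrec.snd.comp Primrec.snd)))
  have h3 := primrec₂_nat_pow.comp hn (hc 3)
  exact primrec₂_nat_pow.comp Primrec.fst (Primrec.nat_mul.comp (primrec₂_nat_pow.comp (hc 2) h3)
    (Primrec.nat_mul.comp h3 (hc 2)))

/-! ### Agreement of an automaton with its description -/

namespace DFAO

variable {k n : ℕ} {Δ : Type*} (M : DFAO k (Fin n) Δ) (name : Δ → ℕ)

theorem codeBound_code : codeBound (M.code name) = pumpingBound k n := by
  simp [codeBound, code]

theorem codeState_code (hk : 2 ≤ k) (i : ℕ) : codeState (M.code name) i = M.state i := by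
  induction i using Nat.strong_induction_on with
  | _ i ih =>
    rw [codeState]
    rcases Nat.eq_zero_or_pos i with rfl | hi
    · rw [if_pos rfl, M.state_zero]
      rfl
    · have hlt : i / k < i := Nat.div_lt_self hi (by omega)
      have hmod : i % k < k := Nat.mod_lt _ (by omega)
      have e : (M.code name).1 = k := rfl
      rw [if_neg hi.ne', e, dif_pos hlt, ih _ hlt, M.state_of_pos hk hi]
      simp [code, hmod]

variable {M name}

theorem Generates.codeSeq_code {a : ℕ → Δ} (h : M.Generates a) (hk : 2 ≤ k) (i : ℕ) :
    codeSeq (M.code name) i = name (a i) := by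
  rw [codeSeq, codeState_code M name hk, h.eq_out_state hk]
  simp [code]

/-- Repetitions only involve equality of letters, which an injective renaming preserves. -/
theorem Generates.hasRepetition_code {a : ℕ → Δ} (h : M.Generates a) (hk : 2 ≤ k)
    (hname : Function.Injective name) :
    HasRepetition (codeSeq (M.code name)) = HasRepetition a := by
  ext p m
  simp only [HasRepetition, h.codeSeq_code hk, hname.eq_iff]

end DFAO

end AutSeq

theorem mainTheorem8 :
    (∀ (k : ℕ) (Δ : Type*) [Finite Δ] (a : ℕ → Δ), IsAutomatic k a →
      RationalOrInfinite (ice₁ a) ∧ RationalOrInfinite (ice₂ a)) ∧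
    (∃ F₁ F₂ : DFAOCode → Option (ℕ × ℕ), Computable F₁ ∧ Computable F₂ ∧
      ∀ (k n : ℕ) (Δ : Type*) [Finite Δ] (M : DFAO k (Fin n) Δ) (name : Δ → ℕ) (a : ℕ → Δ),
        2 ≤ k → Function.Injective name → M.Generates a →
          Denotes (F₁ (M.code name)) (ice₁ a) ∧ Denotes (F₂ (M.code name)) (ice₂ a)) := by
  refine ⟨?_, fun c => searchExponent (codeBound c) 0 (HasRepetition (codeSeq c)),
    fun c => searchExponent (codeBound c) (2 * ((codeBound c).factorial * codeBound c))
      (HasRepetition (codeSeq c)),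
    (primrec_searchExponent primrec_codeBound (Primrec.const 0)).to_comp,
    (primrec_searchExponent primrec_codeBound (Primrec.nat_mul.comp (Primrec.const 2)
      (Primrec.nat_mul.comp (primrec_factorial.comp primrec_codeBound)
        primrec_codeBound))).to_comp, ?_⟩
  · rintro k Δ _ a ⟨hk, σ, _, M, hM⟩
    have h := denotes_searchExponent (hM.isPumpable hk)
    exact ⟨h.1.rationalOrInfinite, h.2.rationalOrInfinite⟩
  · intro k n Δ _ M name a hk hname hM
    have h := denotes_searchExponent (hM.isPumpable hk)
    rw [Nat.card_fin] at h
    simpa only [M.codeBound_code name, hM.hasRepetition_code hk hname] using h
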